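/- Let $\mathcal{A}$ be an additive category. Let $K(\mathcal{A})$ be the homotopy category of ($\mathbb{Z}$-indexed, unbounded) complexes in $\mathcal{A}$, let $K^b(\mathcal{A})\subset K(\mathcal{A})$ be the full subcategory of bounded complexes, i.e. of complexes that are zero in all degrees $<a$ and in all degrees $>b$ for some integers $a,b$, and let $K(\mathcal{A})^b\subset K(\mathcal{A})$ be the closure of $K^b(\mathcal{A})$ under isomorphisms in $K(\mathcal{A})$. A category is called idempotent complete if every idempotent endomorphism $e:X\to X$ splits, i.e. there are an object $Y$ and morphisms $p:X\to Y$ and $i:Y\to X$ with $ip=e$ and $pi=\mathrm{id}_Y$. 1. If $\mathcal{A}$ is abelian, then $K(\mathcal{A})$ is idempotent complete. 2. If $\mathcal{A}$ has countable coproducts, then $K(\mathcal{A})$ is idempotent complete. 3. If $\mathcal{A}$ is idempotent complete, then $K^b(\mathcal{A})$ and $K(\mathcal{A})^b$ are idempotent complete. -/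

import Mathlib

open CategoryTheory CategoryTheory.Limits

universe v u

/-- The homotopy category `K(A)` of (unbounded, `ℤ`-indexed) cochain complexes in `A`. -/
abbrev HotCat (A : Type u) [Category.{v} A] [Preadditive A] : Type (max u v) :=
  HomotopyCategory A (ComplexShape.up ℤ)

/-- The objects of `K(A)` that are bounded complexes: they vanish in all degrees `< a` and in all
degrees `> b`, for some integers `a` and `b`. This is not closed under isomorphisms in `K(A)`. -/
def boundedObjects (A : Type u) [Category.{v} A] [Preadditive A] : ObjectProperty (HotCat A) :=
  fun X ↦ ∃ a b : ℤ, CochainComplex.IsStrictlyGE X.as a ∧ CochainComplex.IsStrictlyLE X.as b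

/-- `K^b(A)`: the full subcategory of `K(A)` of all bounded complexes. -/
abbrev HotCatBounded (A : Type u) [Category.{v} A] [Preadditive A] : Type (max u v) :=
  (boundedObjects A).FullSubcategory

/-- `K(A)^b`: the closure of `K^b(A)` under isomorphisms in `K(A)`. -/
abbrev HotCatBoundedClosure (A : Type u) [Category.{v} A] [Preadditive A] : Type (max u v) :=
  (boundedObjects A).isoClosure.FullSubcategory

/-!
The proof is an Eilenberg swindle which stays inside a pretriangulated category. Let `e` be an
idempotent of `X`, with image `Y` in the idempotent completion. The cone of `1 - e` is
`Y ⊕ Y[1]` (`nonempty_imageSum_of_distinguished`), so this sum exists even if `Y` does not. Hence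
`P = (Y ⊕ Y[1]) ⊕ (Y[2] ⊕ Y[3]) ⊕ ⋯` and `Q = (Y[1] ⊕ Y[2]) ⊕ (Y[3] ⊕ Y[4]) ⊕ ⋯` exist as soon as
these countable coproducts do, and `P = Y ⊕ Q`. A split monomorphism in a pretriangulated category
has a complement, namely its cone; so `Y` exists too (`endoSplits_of_imageSum`). The same works
with shifts to the right, because the images of `e` and of its shift play symmetric roles.

* If `A` has countable coproducts, then so does `K(A)`, and all idempotents split.
* For a complex bounded above, the complexes in the swindle move to the left, so that the
  coproducts are finite in each degree and exist in any additive category; for a complex bounded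
  below one shifts to the right. Thus idempotents of such complexes always split in `K(A)`
  (`endoSplits_of_isStrictlyLE`, `endoSplits_of_isStrictlyGE`).
* If `A` is abelian, a complex `K` sits in a distinguished triangle whose first term is its
  canonical truncation `K.truncLE 0`, and whose third term is contractible in low degrees, hence
  homotopy equivalent to a complex bounded below. Idempotents of `K` restrict to the truncation,
  and `endoSplits_of_distinguished` splits them from splittings on the two outer terms.
* If `A` is idempotent complete and `K` is bounded, an idempotent of `K` splits through some complex
  `Y`, as `K` is bounded above. Being a retract of `K` up to homotopy, `Y` is contractible in
  the degrees where `K` vanishes; splitting an idempotent in each of the two boundary degrees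
  replaces `Y` by a bounded complex (`exists_isStrictlyGE_iso`, `exists_isStrictlyLE_iso`).
-/

section

open Category Pretriangulated

/-! ### Splitting idempotents in pretriangulated categories -/

section Preadditive

variable {T : Type u} [Category.{v} T]

/-- An endomorphism `e` splits if it factors through a retraction onto some object. -/
def EndoSplits {X : T} (e : X ⟶ X) : Prop :=
  ∃ (Y : T) (i : Y ⟶ X) (p : X ⟶ Y), i ≫ p = 𝟙 Y ∧ p ≫ i = e

variable [Preadditive T]

/-- An object `C` which is, in the idempotent completion, the direct sum of the images of two
idempotents `e : X ⟶ X` and `e' : X' ⟶ X'`. -/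
structure ImageSum {X X' : T} (e : X ⟶ X) (e' : X' ⟶ X') (C : T) where
  /-- the inclusion of the image of `e`, extended by zero to `X` -/
  i : X ⟶ C
  /-- the projection to the image of `e` -/
  p : C ⟶ X
  /-- the inclusion of the image of `e'`, extended by zero to `X'` -/
  j : X' ⟶ C
  /-- the projection to the image of `e'` -/
  q : C ⟶ X'
  ip : i ≫ p = e
  jq : j ≫ q = e'
  iq : i ≫ q = 0
  jp : j ≫ p = 0
  ei : e ≫ i = i
  pe : p ≫ e = p
  ej : e' ≫ j = j
  qe : q ≫ e' = q
  total : p ≫ i + q ≫ j = 𝟙 C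

namespace ImageSum

variable {X X' : T} {e : X ⟶ X} {e' : X' ⟶ X'} {C : T}

attribute [simp] ip jq iq jp

@[simp]
lemma ip_assoc (s : ImageSum e e' C) {Z : T} (f : X ⟶ Z) : s.i ≫ s.p ≫ f = e ≫ f := by
  rw [← assoc, s.ip]

@[simp]
lemma jq_assoc (s : ImageSum e e' C) {Z : T} (f : X' ⟶ Z) : s.j ≫ s.q ≫ f = e' ≫ f := by
  rw [← assoc, s.jq]

@[simp]
lemma iq_assoc (s : ImageSum e e' C) {Z : T} (f : X' ⟶ Z) : s.i ≫ s.q ≫ f = 0 := by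
  rw [← assoc, s.iq, zero_comp]

@[simp]
lemma jp_assoc (s : ImageSum e e' C) {Z : T} (f : X ⟶ Z) : s.j ≫ s.p ≫ f = 0 := by
  rw [← assoc, s.jp, zero_comp]

/-- The two summands may be exchanged. -/
def symm (s : ImageSum e e' C) : ImageSum e' e C :=
  ⟨s.j, s.q, s.i, s.p, s.jq, s.ip, s.jp, s.iq, s.ej, s.qe, s.ei, s.pe,
    (add_comm _ _).trans s.total⟩

/-- The second idempotent may be replaced by a conjugate one. -/
def ofIsoRight (s : ImageSum e e' C) {X'' : T} (φ : X' ≅ X'') {e'' : X'' ⟶ X''}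
    (h : e' ≫ φ.hom = φ.hom ≫ e'') : ImageSum e e'' C where
  i := s.i
  p := s.p
  j := φ.inv ≫ s.j
  q := s.q ≫ φ.hom
  ip := s.ip
  jq := by simp [h]
  iq := by rw [← assoc, s.iq, zero_comp]
  jp := by simp
  ei := s.ei
  pe := s.pe
  ej := by
    have : e'' ≫ φ.inv = φ.inv ≫ e' := by rw [Iso.eq_inv_comp, ← assoc, ← h]; simp
    rw [← assoc, this, assoc, s.ej]
  qe := by rw [assoc, ← h, ← assoc, s.qe]
  total := by simp [s.total]

end ImageSum

/-- Two idempotents whose difference has square zero have isomorphic images, so that one splits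
if the other does. -/
lemma EndoSplits.of_sub_sq_eq_zero {X : T} {e e' : X ⟶ X} (he : e ≫ e = e) (he' : e' ≫ e' = e')
    (h : (e - e') ≫ (e - e') = 0) (hs : EndoSplits e') : EndoSplits e := by
  obtain ⟨Y, i, p, hip, hpi⟩ := hs
  -- Multiplying the hypothesis by `e`, respectively `e'`, on both sides gives `key` and `key'`.
  have key : e ≫ e' ≫ e = e := by
    have : e ≫ ((e - e') ≫ (e - e')) ≫ e = 0 := by rw [h]; simp
    simp only [Preadditive.sub_comp, Preadditive.comp_sub, assoc, he, he',
      reassoc_of% he] at this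
    grind
  have key' : e' ≫ e ≫ e' = e' := by
    have : e' ≫ ((e - e') ≫ (e - e')) ≫ e' = 0 := by rw [h]; simp
    simp only [Preadditive.sub_comp, Preadditive.comp_sub, assoc, he, he',
      reassoc_of% he'] at this
    grind
  refine ⟨Y, i ≫ e, e ≫ p, ?_, ?_⟩
  · have : i ≫ e' = i := by rw [← hpi, reassoc_of% hip]
    have h2 : e' ≫ p = p := by rw [← hpi, assoc, hip, comp_id]
    calc (i ≫ e) ≫ e ≫ p = i ≫ (e' ≫ e ≫ e') ≫ p := by
          rw [assoc, reassoc_of% he, assoc, assoc, h2, reassoc_of% this]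
      _ = 𝟙 Y := by rw [key', h2, hip]
  · rw [assoc, reassoc_of% hpi, key]

end Preadditive

section Pretriangulated

variable {T : Type u} [Category.{v} T] [Preadditive T] [HasZeroObject T] [HasShift T ℤ]
  [∀ n : ℤ, (shiftFunctor T n).Additive] [Pretriangulated T]

/-- The cone of a split monomorphism is a direct complement, so the complementary idempotent
splits through it. -/
lemma exists_splitting_of_split_mono {Q P C : T} (f : Q ⟶ P) (r : P ⟶ Q) (hfr : f ≫ r = 𝟙 Q)
    (g : P ⟶ C) (w : C ⟶ Q⟦(1 : ℤ)⟧) (hT : Triangle.mk f g w ∈ distTriang T) :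
    ∃ m : C ⟶ P, m ≫ g = 𝟙 C ∧ g ≫ m = 𝟙 P - r ≫ f := by
  have hfg : f ≫ g = 0 := comp_distTriang_mor_zero₁₂ _ hT
  have hwf : w ≫ f⟦(1 : ℤ)⟧' = 0 := comp_distTriang_mor_zero₃₁ _ hT
  have hw : w = 0 := by
    have := congr($hwf ≫ r⟦(1 : ℤ)⟧')
    rwa [assoc, ← CategoryTheory.Functor.map_comp, hfr, CategoryTheory.Functor.map_id, comp_id,
      zero_comp] at this
  obtain ⟨m, hm⟩ : ∃ m : C ⟶ P, 𝟙 P - r ≫ f = g ≫ m :=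
    Triangle.yoneda_exact₂ _ hT (𝟙 P - r ≫ f) (by
      change f ≫ _ = 0
      simp [reassoc_of% hfr])
  refine ⟨m, ?_, hm.symm⟩
  have hg : Epi g := Triangle.epi₂ _ hT hw
  rw [← cancel_epi g, ← assoc, ← hm]
  simp [hfg]

/-- The cone of the complementary idempotent `1 - e` is the sum of the image of `e` and
of its shift. -/
lemma nonempty_imageSum_of_distinguished {X C : T} (e : X ⟶ X) (he : e ≫ e = e)
    (g : X ⟶ C) (w : C ⟶ X⟦(1 : ℤ)⟧) (hT : Triangle.mk (𝟙 X - e) g w ∈ distTriang T) :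
    Nonempty (ImageSum e (e⟦(1 : ℤ)⟧') C) := by
  have h1 : (𝟙 X - e) ≫ g = 0 := comp_distTriang_mor_zero₁₂ _ hT
  have hg : e ≫ g = g := by
    rw [Preadditive.sub_comp, id_comp, sub_eq_zero] at h1; exact h1.symm
  have hgw : g ≫ w = 0 := comp_distTriang_mor_zero₂₃ _ hT
  have h2 : w ≫ (𝟙 X - e)⟦(1 : ℤ)⟧' = 0 := comp_distTriang_mor_zero₃₁ _ hT
  have hw : w ≫ e⟦(1 : ℤ)⟧' = w := by
    rw [Functor.map_sub, CategoryTheory.Functor.map_id, Preadditive.comp_sub, comp_id,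
      sub_eq_zero] at h2
    exact h2.symm
  have he' : e⟦(1 : ℤ)⟧' ≫ e⟦(1 : ℤ)⟧' = e⟦(1 : ℤ)⟧' := by
    rw [← CategoryTheory.Functor.map_comp, he]
  have hee' : e⟦(1 : ℤ)⟧' ≫ (𝟙 X - e)⟦(1 : ℤ)⟧' = 0 := by
    rw [← CategoryTheory.Functor.map_comp, Preadditive.comp_sub, comp_id, he, sub_self,
      Functor.map_zero]
  obtain ⟨p₀, hp₀⟩ : ∃ p₀ : C ⟶ X, e = g ≫ p₀ := Triangle.yoneda_exact₂ _ hT e (by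
    change (𝟙 X - e) ≫ e = 0
    simp [he])
  obtain ⟨j₀, hj₀⟩ : ∃ j₀ : X⟦(1 : ℤ)⟧ ⟶ C, e⟦(1 : ℤ)⟧' = j₀ ≫ w :=
    Triangle.coyoneda_exact₁ _ hT (e⟦(1 : ℤ)⟧') hee'
  let p := p₀ ≫ e
  have hgp : g ≫ p = e := by simp only [p]; rw [← assoc, ← hp₀, he]
  have hpe : p ≫ e = p := by simp only [p, assoc, he]
  -- `j₀` need not vanish on the image of `e`; correct it there.
  let j := e⟦(1 : ℤ)⟧' ≫ j₀ ≫ (𝟙 C - p ≫ g)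
  have hjw : j ≫ w = e⟦(1 : ℤ)⟧' := by simp [j, hgw, ← hj₀, he']
  have hjp : j ≫ p = 0 := by simp [j, hgp, hpe]
  have hej : e⟦(1 : ℤ)⟧' ≫ j = j := by simp only [j]; rw [← assoc, he']
  refine ⟨⟨g, p, j, w, hgp, hjw, hgw, hjp, hg, hpe, hej, hw, ?_⟩⟩
  -- The defect `d` of the last identity kills `g`, and is killed by `p` and by `w`.
  let d := 𝟙 C - (p ≫ g + w ≫ j)
  have hgd : g ≫ d = 0 := by
    simp [d, reassoc_of% hgp, reassoc_of% hgw, hg]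
  obtain ⟨t, ht⟩ : ∃ t, d = w ≫ t := Triangle.yoneda_exact₃ _ hT d hgd
  have hdw : d ≫ w = 0 := by simp [d, hgw, hjw, hw]
  have hdp : d ≫ p = 0 := by simp [d, hgp, hjp, hpe]
  have hdd : d ≫ d = d := by
    conv_lhs => enter [2]; simp only [d]
    rw [Preadditive.comp_sub, Preadditive.comp_add, reassoc_of% hdw, reassoc_of% hdp]
    simp
  have : d = 0 := by
    rw [← hdd]
    conv_lhs => enter [2]; rw [ht]
    rw [reassoc_of% hdw, zero_comp]
  exact (sub_eq_zero.1 this).symm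

/-- Swindle: let `D k` be the sum of the images of `e k` and `e' k`, and `D' k` the sum of
those of `e' k` and `e (k + 1)`. Bracketing the sum of all the images in two ways shows that the
image of `e 0` is a complement of `∐ D'` in `∐ D`, so that it is realized by the cone of a split
monomorphism. -/
lemma endoSplits_of_imageSum {X X' : ℕ → T} (e : ∀ k, X k ⟶ X k) (e' : ∀ k, X' k ⟶ X' k)
    {D D' : ℕ → T} (s : ∀ k, ImageSum (e k) (e' k) (D k))
    (s' : ∀ k, ImageSum (e' k) (e (k + 1)) (D' k)) [HasCoproduct D] [HasCoproduct D'] :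
    EndoSplits (e 0) := by
  let ι : ∀ k, D k ⟶ ∐ D := Sigma.ι D
  let ι' : ∀ k, D' k ⟶ ∐ D' := Sigma.ι D'
  let f : ∐ D' ⟶ ∐ D := Sigma.desc fun k ↦
    (s' k).p ≫ (s k).j ≫ ι k + (s' k).q ≫ (s (k + 1)).i ≫ ι (k + 1)
  let r₀ : ∀ k, D k ⟶ ∐ D' := fun k ↦ match k with
    | 0 => 0
    | k + 1 => (s (k + 1)).p ≫ (s' k).j ≫ ι' k
  let r : ∐ D ⟶ ∐ D' := Sigma.desc fun k ↦ (s k).q ≫ (s' k).i ≫ ι' k + r₀ k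
  let v₀ : ∀ k, D k ⟶ X 0 := fun k ↦ match k with
    | 0 => (s 0).p
    | k + 1 => 0
  let v : ∐ D ⟶ X 0 := Sigma.desc v₀
  have hf : ∀ k, ι' k ≫ f = (s' k).p ≫ (s k).j ≫ ι k +
      (s' k).q ≫ (s (k + 1)).i ≫ ι (k + 1) := fun k ↦ Sigma.ι_desc _ _
  have hr : ∀ k, ι k ≫ r = (s k).q ≫ (s' k).i ≫ ι' k + r₀ k := fun k ↦ Sigma.ι_desc _ _
  have hr₀ : ∀ k, r₀ (k + 1) = (s (k + 1)).p ≫ (s' k).j ≫ ι' k := fun k ↦ rfl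
  have hjr : ∀ k, (s k).j ≫ r₀ k = 0 := by
    rintro (_ | k)
    · exact comp_zero
    · rw [hr₀, ImageSum.jp_assoc]
  have hv : ∀ k, ι k ≫ v = v₀ k := fun k ↦ Sigma.ι_desc _ _
  have hfr : f ≫ r = 𝟙 _ := by
    refine Sigma.hom_ext _ _ fun k ↦ ?_
    change ι' k ≫ f ≫ r = ι' k ≫ 𝟙 _
    rw [← assoc, hf, Preadditive.add_comp, assoc, assoc, assoc, assoc, hr, hr, hr₀]
    simp only [Preadditive.comp_add]
    rw [hjr, ImageSum.jq_assoc, ImageSum.iq_assoc,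
      ImageSum.ip_assoc, comp_zero, comp_zero, add_zero, zero_add, ← assoc (e' k), (s' k).ei,
      ← assoc (e _), (s' k).ej, ← assoc, ← assoc, ← Preadditive.add_comp,
      (s' k).total, id_comp, comp_id]
  have hrf : 𝟙 _ - r ≫ f = v ≫ (s 0).i ≫ ι 0 := by
    refine Sigma.hom_ext _ _ fun k ↦ ?_
    change ι k ≫ (𝟙 _ - r ≫ f) = ι k ≫ v ≫ _
    rw [Preadditive.comp_sub, ← assoc, ← assoc, hr, hv, comp_id, sub_eq_iff_eq_add,
      Preadditive.add_comp, assoc, assoc, hf, Preadditive.comp_add, ImageSum.ip_assoc,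
      ImageSum.iq_assoc, add_zero, ← assoc (e' k), (s k).ej]
    rcases k with _ | k
    · change ι 0 = (s 0).p ≫ (s 0).i ≫ ι 0 + ((s 0).q ≫ (s 0).j ≫ ι 0 + 0 ≫ f)
      rw [zero_comp, add_zero, ← assoc, ← assoc, ← Preadditive.add_comp, (s 0).total, id_comp]
    · change _ = 0 ≫ _ + (_ + _)
      rw [hr₀, assoc, assoc, hf, Preadditive.comp_add, ImageSum.jp_assoc, ImageSum.jq_assoc,
        zero_comp, zero_add, zero_add, ← assoc (e _), (s _).ei,
        ← assoc, ← assoc, ← Preadditive.add_comp, add_comm (_ ≫ _), (s _).total, id_comp]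
  obtain ⟨Z, g, w, hT⟩ := distinguished_cocone_triangle f
  obtain ⟨m, hmg, hgm⟩ := exists_splitting_of_split_mono f r hfr g w hT
  have huv : (s 0).i ≫ ι 0 ≫ v = e 0 := by
    rw [hv]; exact (s 0).ip
  have hv' : v ≫ e 0 = v := by
    refine Sigma.hom_ext _ _ fun k ↦ ?_
    change ι k ≫ v ≫ e 0 = ι k ≫ v
    rw [← assoc, hv]
    rcases k with _ | k
    · exact (s 0).pe
    · exact zero_comp
  rw [hrf] at hgm
  refine ⟨Z, m ≫ v, (s 0).i ≫ ι 0 ≫ g, ?_, ?_⟩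
  · calc (m ≫ v) ≫ (s 0).i ≫ ι 0 ≫ g = m ≫ (v ≫ (s 0).i ≫ ι 0) ≫ g := by simp only [assoc]
      _ = 𝟙 Z := by rw [← hgm, assoc, hmg, comp_id, hmg]
  · calc ((s 0).i ≫ ι 0 ≫ g) ≫ m ≫ v = (s 0).i ≫ ι 0 ≫ (g ≫ m) ≫ v := by simp only [assoc]
      _ = e 0 := by
        rw [hgm, assoc, assoc, huv, hv', huv]

/-- Form of the swindle in which the successive idempotents are produced by a step that improves
a property `P k` of the objects to `P (k + 1)`. -/
lemma endoSplits_of_imageSum_step (P : ℕ → ObjectProperty T)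
    (step : ∀ (k : ℕ) (X : T) (e : X ⟶ X), P k X → e ≫ e = e →
      ∃ (X' : T) (e' : X' ⟶ X') (C : T), P (k + 1) X' ∧ e' ≫ e' = e' ∧ P k C ∧
        Nonempty (ImageSum e e' C))
    (coprod : ∀ D : ℕ → T, (∀ k, ∃ j, k ≤ j ∧ P j (D k)) → HasCoproduct D)
    {X : T} (hX : P 0 X) {e : X ⟶ X} (he : e ≫ e = e) : EndoSplits e := by
  let St (k : ℕ) := { x : Σ X : T, (X ⟶ X) // P k x.1 ∧ x.2 ≫ x.2 = x.2 }
  have step' (k : ℕ) (x : St k) : ∃ (y : St (k + 1)) (C : T), P k C ∧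
      Nonempty (ImageSum x.1.2 y.1.2 C) := by
    obtain ⟨X', e', C, h1, h2, h3, h4⟩ := step k x.1.1 x.1.2 x.2.1 x.2.2
    exact ⟨⟨⟨X', e'⟩, h1, h2⟩, C, h3, h4⟩
  choose next C hC hs using step'
  let x (k : ℕ) : St k := Nat.rec ⟨⟨X, e⟩, hX, he⟩ next k
  have h0 : HasCoproduct fun k ↦ C (2 * k) (x (2 * k)) :=
    coprod _ fun k ↦ ⟨2 * k, by lia, hC _ _⟩
  have h1 : HasCoproduct fun k ↦ C (2 * k + 1) (x (2 * k + 1)) :=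
    coprod _ fun k ↦ ⟨2 * k + 1, by lia, hC _ _⟩
  exact endoSplits_of_imageSum (fun k ↦ (x (2 * k)).1.2) (fun k ↦ (x (2 * k + 1)).1.2)
    (fun k ↦ (hs (2 * k) (x (2 * k))).some) (fun k ↦ (hs (2 * k + 1) (x (2 * k + 1))).some)

/-- In a distinguished triangle, an idempotent of the middle object which is compatible with
an idempotent of the first object splits, if all idempotents of the two outer objects do. -/
lemma endoSplits_of_distinguished {U X V : T} (f : U ⟶ X) (g : X ⟶ V) (w : V ⟶ U⟦(1 : ℤ)⟧)
    (hT : Triangle.mk f g w ∈ distTriang T)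
    (hU : ∀ a : U ⟶ U, a ≫ a = a → EndoSplits a) (hV : ∀ b : V ⟶ V, b ≫ b = b → EndoSplits b)
    {a : U ⟶ U} {e : X ⟶ X} (ha : a ≫ a = a) (he : e ≫ e = e) (hae : f ≫ e = a ≫ f) :
    EndoSplits e := by
  have ha' : a⟦(1 : ℤ)⟧' ≫ a⟦(1 : ℤ)⟧' = a⟦(1 : ℤ)⟧' := by
    rw [← CategoryTheory.Functor.map_comp, ha]
  obtain ⟨b₀, hgb₀, hwb₀⟩ : ∃ b₀ : V ⟶ V, g ≫ b₀ = e ≫ g ∧ w ≫ a⟦(1 : ℤ)⟧' = b₀ ≫ w :=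
    complete_distinguished_triangle_morphism _ _ hT hT a e hae
  -- `b₀` is idempotent up to `n`, which has square zero; `b₀ + n - 2 b₀ n` is idempotent.
  let n := b₀ ≫ b₀ - b₀
  have hgn : g ≫ n = 0 := by
    simp only [n, Preadditive.comp_sub, reassoc_of% hgb₀, hgb₀, reassoc_of% he, sub_self]
  have hnw : n ≫ w = 0 := by
    simp only [n, Preadditive.sub_comp, assoc, ← hwb₀, reassoc_of% (hwb₀.symm), ha', sub_self]
  obtain ⟨t, ht⟩ : ∃ t, n = w ≫ t := Triangle.yoneda_exact₃ _ hT n hgn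
  have hnn : n ≫ n = 0 := by
    conv_lhs => enter [2]; rw [ht]
    rw [reassoc_of% hnw, zero_comp]
  have hbn : b₀ ≫ n = n ≫ b₀ := by
    simp only [n, Preadditive.comp_sub, Preadditive.sub_comp, assoc]
  have hbb : b₀ ≫ b₀ = b₀ + n := by simp [n]
  let b := b₀ + n - (b₀ ≫ n + b₀ ≫ n)
  have hb : b ≫ b = b := by
    have h1 : b₀ ≫ b₀ ≫ n = b₀ ≫ n := by
      rw [← assoc, hbb, Preadditive.add_comp, hnn, add_zero]
    have h2 : n ≫ b₀ ≫ n = 0 := by rw [← assoc, ← hbn, assoc, hnn, comp_zero]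
    have h4 : n ≫ b₀ = b₀ ≫ n := hbn.symm
    simp only [b, Preadditive.comp_sub, Preadditive.sub_comp, Preadditive.comp_add,
      Preadditive.add_comp, assoc, hbb, hnn, h1, h2, h4, comp_zero]
    abel
  have hgb : g ≫ b = e ≫ g := by
    simp only [b, Preadditive.comp_sub, Preadditive.comp_add, hgn, hgb₀, reassoc_of% hgb₀,
      comp_zero, add_zero, sub_zero]
  have hwb : w ≫ a⟦(1 : ℤ)⟧' = b ≫ w := by
    simp only [b, Preadditive.sub_comp, Preadditive.add_comp, hnw, ← hwb₀, assoc,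
      comp_zero, add_zero, sub_zero]
  -- Split `a` through `U₁` and `b` through `V₁`, and complete `V₁ ⟶ U₁⟦1⟧` to a triangle with
  -- middle term `X₁`; this makes `X₁` a retract of `X`.
  obtain ⟨U₁, i, p, hip, hpi⟩ := hU a ha
  obtain ⟨V₁, j, q, hjq, hqj⟩ := hV b hb
  have hap : a ≫ p = p := by rw [← hpi, assoc, hip, comp_id]
  have hjb : j ≫ b = j := by rw [← hqj, reassoc_of% hjq]
  obtain ⟨X₁, f₁, g₁, hT₁⟩ := distinguished_cocone_triangle₂ (j ≫ w ≫ p⟦(1 : ℤ)⟧')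
  obtain ⟨α, hα₁, hα₂⟩ : ∃ α : X₁ ⟶ X, f₁ ≫ α = i ≫ f ∧ g₁ ≫ j = α ≫ g :=
    complete_distinguished_triangle_morphism₂ _ _ hT₁ hT i j (by
    change (j ≫ w ≫ p⟦(1 : ℤ)⟧') ≫ i⟦(1 : ℤ)⟧' = j ≫ w
    rw [assoc, assoc, ← CategoryTheory.Functor.map_comp, hpi, hwb, reassoc_of% hjb])
  obtain ⟨β, hβ₁, hβ₂⟩ : ∃ β : X ⟶ X₁, f ≫ β = p ≫ f₁ ∧ g ≫ q = β ≫ g₁ :=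
    complete_distinguished_triangle_morphism₂ _ _ hT hT₁ p q (by
    change w ≫ p⟦(1 : ℤ)⟧' = q ≫ j ≫ w ≫ p⟦(1 : ℤ)⟧'
    rw [reassoc_of% hqj, ← reassoc_of% hwb, ← CategoryTheory.Functor.map_comp, hap])
  have h1 : f₁ ≫ α ≫ β = f₁ := by rw [reassoc_of% hα₁, hβ₁, reassoc_of% hip]
  have h2 : (α ≫ β) ≫ g₁ = g₁ := by rw [assoc, ← hβ₂, ← reassoc_of% hα₂, hjq, comp_id]
  have hiso : IsIso (α ≫ β) := by
    have h3 : (j ≫ w ≫ p⟦(1 : ℤ)⟧') ≫ (𝟙 U₁)⟦(1 : ℤ)⟧' = 𝟙 V₁ ≫ j ≫ w ≫ p⟦(1 : ℤ)⟧' := by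
      rw [CategoryTheory.Functor.map_id, id_comp, comp_id]
    let φ : Triangle.mk f₁ g₁ (j ≫ w ≫ p⟦(1 : ℤ)⟧') ⟶ Triangle.mk f₁ g₁ (j ≫ w ≫ p⟦(1 : ℤ)⟧') :=
      { hom₁ := 𝟙 _
        hom₂ := α ≫ β
        hom₃ := 𝟙 _
        comm₁ := h1.trans (id_comp f₁).symm
        comm₂ := (comp_id g₁).trans h2.symm
        comm₃ := h3 }
    exact isIso₂_of_isIso₁₃ φ hT₁ hT₁ (inferInstanceAs (IsIso (𝟙 _)))
      (inferInstanceAs (IsIso (𝟙 _)))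
  let γ := inv (α ≫ β)
  have hγ : (α ≫ β) ≫ γ = 𝟙 _ := IsIso.hom_inv_id _
  have hγ' : γ ≫ α ≫ β = 𝟙 _ := IsIso.inv_hom_id _
  have hfγ : f₁ ≫ γ = f₁ := by
    conv_lhs => rw [← h1]
    rw [assoc, hγ, comp_id]
  have hγg : γ ≫ g₁ = g₁ := by
    conv_lhs => rw [← h2]
    rw [← assoc, hγ', id_comp]
  have hs : α ≫ β ≫ γ = 𝟙 _ := by rw [← assoc, hγ]
  -- The idempotent `β ≫ γ ≫ α` of `X` splits through `X₁`, and agrees with `e` up to a square-zero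
  -- endomorphism.
  refine EndoSplits.of_sub_sq_eq_zero (e' := (β ≫ γ) ≫ α) he ?_ ?_ ⟨X₁, α, β ≫ γ, hs, rfl⟩
  · simp only [assoc]
    rw [reassoc_of% hs]
  · -- The difference kills `f` and is killed by `g`.
    have hf : f ≫ (e - (β ≫ γ) ≫ α) = 0 := by
      rw [Preadditive.comp_sub, hae, assoc, reassoc_of% hβ₁, reassoc_of% hfγ, hα₁,
        reassoc_of% hpi, sub_self]
    have hg : (e - (β ≫ γ) ≫ α) ≫ g = 0 := by
      rw [Preadditive.sub_comp, ← hgb, assoc, assoc, ← hα₂, reassoc_of% hγg, ← reassoc_of% hβ₂,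
        hqj, sub_self]
    obtain ⟨t, ht⟩ : ∃ t : V ⟶ X, e - (β ≫ γ) ≫ α = g ≫ t := Triangle.yoneda_exact₂ _ hT _ hf
    conv_lhs => enter [2]; rw [ht]
    rw [← assoc, hg, zero_comp]

end Pretriangulated

/-! ### Coproducts in the homotopy category, and half-bounded complexes -/

section Coproducts

/-- Only finitely many summands matter, so finite biproducts suffice. -/
lemma hasCoproduct_of_eventually_isZero {A : Type u} [Category.{v} A] [Preadditive A]
    [HasFiniteBiproducts A] (f : ℕ → A) (N : ℕ) (h : ∀ k, N ≤ k → IsZero (f k)) :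
    HasCoproduct f := by
  let g : Fin N → A := fun i ↦ f i
  let c : Cofan f := Cofan.mk (⨁ g) fun k ↦
    if hk : k < N then biproduct.ι g ⟨k, hk⟩ else 0
  have hc : ∀ i : Fin N, c.inj i = biproduct.ι g i := fun i ↦ dif_pos i.2
  refine ⟨⟨⟨c, Cofan.IsColimit.mk c (fun s ↦ biproduct.desc fun i ↦ s.inj i) (fun s k ↦ ?_)
    (fun s m hm ↦ ?_)⟩⟩⟩
  · by_cases hk : k < N
    · have := hc ⟨k, hk⟩
      dsimp only at this
      rw [this]
      exact biproduct.ι_desc _ _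
    · exact (h k (not_lt.1 hk)).eq_of_src _ _
  · refine biproduct.hom_ext' _ _ fun i ↦ ?_
    rw [biproduct.ι_desc, ← hm, hc]

/-- A coproduct which is computed degreewise is also a coproduct in the homotopy category. -/
lemma hasCoproduct_quotient_obj {A : Type u} [Category.{v} A] [Preadditive A]
    {ι J : Type} {c : ComplexShape ι} (K : J → HomologicalComplex A c)
    [∀ n, HasCoproduct fun k ↦ (K k).X n] :
    HasCoproduct fun k ↦ (HomotopyCategory.quotient A c).obj (K k) := by
  let F := Discrete.functor K
  have (n : ι) : HasColimit (F ⋙ HomologicalComplex.eval A c n) :=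
    hasColimit_of_iso (F := Discrete.functor fun k ↦ (K k).X n)
      (Discrete.natIso fun _ ↦ Iso.refl _)
  let s := HomologicalComplex.coconeOfHasColimitEval F
  have hs : IsColimit s := HomologicalComplex.isColimitCoconeOfHasColimitEval F
  let in_ (k : J) : K k ⟶ s.pt := s.ι.app ⟨k⟩
  -- A map out of `s.pt` is null-homotopic if its components are: the homotopies assemble.
  have key : ∀ (L : HomologicalComplex A c) (d : s.pt ⟶ L),
      (∀ k, Nonempty (Homotopy (in_ k ≫ d) 0)) → Nonempty (Homotopy d 0) := by
    intro L d H
    let H' (k : J) : Homotopy (in_ k ≫ d) 0 := (H k).some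
    let co (i j : ι) : Cocone (F ⋙ HomologicalComplex.eval A c i) :=
      { pt := L.X j
        ι := Discrete.natTrans fun k ↦ (H' k.as).hom i j }
    let h (i j : ι) : s.pt.X i ⟶ L.X j := colimit.desc _ (co i j)
    have hh : ∀ k i j, (in_ k).f i ≫ h i j = (H' k).hom i j := fun k i j ↦
      colimit.ι_desc (co i j) ⟨k⟩
    have ext : ∀ {i : ι} {Z : A} {f g : s.pt.X i ⟶ Z},
        (∀ k, (in_ k).f i ≫ f = (in_ k).f i ≫ g) → f = g := fun {i Z f g} hfg ↦
      colimit.hom_ext fun k ↦ hfg k.as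
    refine ⟨⟨h, fun i j hij ↦ ext fun k ↦ ?_, fun i ↦ ext fun k ↦ ?_⟩⟩
    · rw [hh, (H' k).zero i j hij, comp_zero]
    · have := (H' k).comm i
      rw [HomologicalComplex.comp_f] at this
      rw [this, HomologicalComplex.zero_f, HomologicalComplex.zero_f, add_zero, add_zero,
        Preadditive.comp_add, ← dNext_comp_left, ← prevD_comp_left]
      simp only [hh]
  let Q := HomotopyCategory.quotient A c
  let t : Cofan fun k ↦ Q.obj (K k) := Cofan.mk (Q.obj s.pt) fun k ↦ Q.map (in_ k)
  let lift (u : Cofan fun k ↦ Q.obj (K k)) : s.pt ⟶ u.pt.as :=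
    hs.desc (Cocone.mk u.pt.as (Discrete.natTrans fun k ↦ (u.inj k.as).out))
  have fac (u : Cofan fun k ↦ Q.obj (K k)) (k : J) : in_ k ≫ lift u = (u.inj k).out :=
    hs.fac _ ⟨k⟩
  have hlift (u : Cofan fun k ↦ Q.obj (K k)) (k : J) :
      Q.map (in_ k) ≫ Q.map (lift u) = u.inj k := by
    rw [← Q.map_comp, fac]
    exact HomotopyCategory.quotient_map_out _
  refine ⟨⟨⟨t, Cofan.IsColimit.mk t (fun u ↦ Q.map (lift u)) hlift (fun u m hm ↦ ?_)⟩⟩⟩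
  obtain ⟨m', hm'⟩ : ∃ m' : s.pt ⟶ u.pt.as, Q.map m' = m := Q.map_surjective m
  subst hm'
  refine sub_eq_zero.1 ?_
  change Q.map m' - Q.map (lift u) = 0
  rw [← Q.map_sub]
  refine (HomotopyCategory.quotient_map_eq_zero_iff _).2 (key _ _ fun k ↦ ?_)
  refine (HomotopyCategory.quotient_map_eq_zero_iff _).1 ?_
  have h1 : Q.map (in_ k) ≫ Q.map m' = u.inj k := hm k
  change Q.map _ = 0
  rw [Q.map_comp, Q.map_sub, Preadditive.comp_sub, hlift, h1]
  exact sub_self _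

/-- A family of complexes has a coproduct in the homotopy category if it is locally finite. -/
lemma hasCoproduct_of_locallyFinite {A : Type u} [Category.{v} A] [Preadditive A]
    [HasFiniteBiproducts A] (D : ℕ → HotCat A)
    (h : ∀ n : ℤ, ∃ N : ℕ, ∀ k, N ≤ k → IsZero ((D k).as.X n)) : HasCoproduct D := by
  have (n : ℤ) : HasCoproduct fun k ↦ (D k).as.X n :=
    hasCoproduct_of_eventually_isZero _ _ (h n).choose_spec
  exact hasCoproduct_quotient_obj fun k ↦ (D k).as

end Coproducts

section HomotopyCategory

variable {A : Type u} [Category.{v} A] [Preadditive A] [HasZeroObject A] [HasBinaryBiproducts A]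

open HomotopyCategory CochainComplex

/-- If `e'` is a shift of the idempotent `e`, the sum of their images is a mapping cone. -/
lemma exists_imageSum_mappingCone {K : CochainComplex A ℤ} {X' : HotCat A}
    (ψ : ((quotient A _).obj K)⟦(1 : ℤ)⟧ ≅ X')
    {e : (quotient A (.up ℤ)).obj K ⟶ (quotient A (.up ℤ)).obj K} (he : e ≫ e = e)
    {e' : X' ⟶ X'} (h : e⟦(1 : ℤ)⟧' ≫ ψ.hom = ψ.hom ≫ e') :
    ∃ φ : K ⟶ K, Nonempty (ImageSum e e' ((quotient A (.up ℤ)).obj (mappingCone φ))) := by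
  obtain ⟨φ, hφ⟩ := (quotient A (.up ℤ)).map_surjective (𝟙 _ - e)
  refine ⟨φ, ?_⟩
  have hT := mappingCone_triangleh_distinguished φ
  obtain ⟨s⟩ := nonempty_imageSum_of_distinguished e he (mappingCone.triangleh φ).mor₂
    (mappingCone.triangleh φ).mor₃ (by rw [← hφ]; exact hT)
  exact ⟨s.ofIsoRight ψ h⟩

/-- The step of the swindle which shifts to the left. -/
lemma exists_imageSum_shift_one (K : CochainComplex A ℤ)
    {e : (quotient A (.up ℤ)).obj K ⟶ (quotient A (.up ℤ)).obj K} (he : e ≫ e = e) :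
    ∃ (e' : (quotient A (.up ℤ)).obj (K⟦(1 : ℤ)⟧) ⟶ (quotient A (.up ℤ)).obj (K⟦(1 : ℤ)⟧))
      (φ : K ⟶ K), e' ≫ e' = e' ∧
      Nonempty (ImageSum e e' ((quotient A (.up ℤ)).obj (mappingCone φ))) := by
  let ψ : ((quotient A (.up ℤ)).obj K)⟦(1 : ℤ)⟧ ≅ (quotient A (.up ℤ)).obj (K⟦(1 : ℤ)⟧) :=
    (((quotient A (.up ℤ)).commShiftIso (1 : ℤ)).app K).symm
  obtain ⟨φ, hφ⟩ := exists_imageSum_mappingCone ψ he (e' := ψ.inv ≫ e⟦(1 : ℤ)⟧' ≫ ψ.hom)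
    (by simp)
  refine ⟨_, φ, ?_, hφ⟩
  rw [assoc, assoc, Iso.hom_inv_id_assoc, ← CategoryTheory.Functor.map_comp_assoc, he]

/-- The step of the swindle which shifts to the right. -/
lemma exists_imageSum_shift_neg_one (K : CochainComplex A ℤ)
    {e : (quotient A (.up ℤ)).obj K ⟶ (quotient A (.up ℤ)).obj K} (he : e ≫ e = e) :
    ∃ (e' : (quotient A (.up ℤ)).obj (K⟦(-1 : ℤ)⟧) ⟶
        (quotient A (.up ℤ)).obj (K⟦(-1 : ℤ)⟧))
      (φ : K⟦(-1 : ℤ)⟧ ⟶ K⟦(-1 : ℤ)⟧), e' ≫ e' = e' ∧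
      Nonempty (ImageSum e e' ((quotient A (.up ℤ)).obj (mappingCone φ))) := by
  let ψ : ((quotient A (.up ℤ)).obj (K⟦(-1 : ℤ)⟧))⟦(1 : ℤ)⟧ ≅ (quotient A (.up ℤ)).obj K :=
    (((quotient A (.up ℤ)).commShiftIso (1 : ℤ)).app _).symm ≪≫
      (quotient A (.up ℤ)).mapIso ((shiftFunctorCompIsoId _ (-1 : ℤ) 1 (by lia)).app K)
  obtain ⟨e', he'⟩ := (CategoryTheory.shiftFunctor (HotCat A) (1 : ℤ)).map_surjective
    (ψ.hom ≫ e ≫ ψ.inv)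
  have hee' : e' ≫ e' = e' := by
    apply (CategoryTheory.shiftFunctor (HotCat A) (1 : ℤ)).map_injective
    rw [CategoryTheory.Functor.map_comp, he']
    simp [reassoc_of% he]
  obtain ⟨φ, ⟨s⟩⟩ := exists_imageSum_mappingCone ψ hee' (e' := e) (by rw [he']; simp)
  exact ⟨e', φ, hee', ⟨s.symm⟩⟩

/-- Idempotents of complexes which are bounded above split: the complexes in the swindle move
to the left, so that they form a locally finite family. -/
lemma endoSplits_of_isStrictlyLE [HasFiniteBiproducts A] (X : HotCat A) (N : ℤ)
    (hX : IsStrictlyLE X.as N) {e : X ⟶ X} (he : e ≫ e = e) : EndoSplits e := by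
  refine endoSplits_of_imageSum_step (fun k X ↦ IsStrictlyLE X.as (N - k)) ?_ ?_ (by simpa) he
  · intro k X e hX he
    obtain ⟨K, rfl⟩ := quotient_obj_surjective X
    have hX : IsStrictlyLE K (N - k) := hX
    obtain ⟨e', φ, he', hs⟩ := exists_imageSum_shift_one K he
    refine ⟨_, e', _, isStrictlyLE_shift K (N - k) _ _ (by push_cast; ring), he', ?_, hs⟩
    refine (isStrictlyLE_iff _ _).2 fun i hi ↦ (mappingCone.isZero_X_iff _ _).2 ⟨?_, ?_⟩
    · exact isZero_of_isStrictlyLE K (N - k) _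
    · exact isZero_of_isStrictlyLE K (N - k) _
  · intro D hD
    refine hasCoproduct_of_locallyFinite D fun n ↦ ⟨(N - n + 1).toNat, fun k hk ↦ ?_⟩
    obtain ⟨j, hkj, hj⟩ := hD k
    exact isZero_of_isStrictlyLE (D k).as (N - j) _

/-- Idempotents of complexes which are bounded below split: the complexes in the swindle move
to the right, so that they form a locally finite family. -/
lemma endoSplits_of_isStrictlyGE [HasFiniteBiproducts A] (X : HotCat A) (N : ℤ)
    (hX : IsStrictlyGE X.as N) {e : X ⟶ X} (he : e ≫ e = e) : EndoSplits e := by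
  refine endoSplits_of_imageSum_step (fun k X ↦ IsStrictlyGE X.as (N + k)) ?_ ?_ (by simpa) he
  · intro k X e hX he
    obtain ⟨K, rfl⟩ := quotient_obj_surjective X
    have hX : IsStrictlyGE K (N + k) := hX
    obtain ⟨e', φ, he', hs⟩ := exists_imageSum_shift_neg_one K he
    have hX' : IsStrictlyGE (K⟦(-1 : ℤ)⟧) (N + (k + 1 : ℕ)) :=
      isStrictlyGE_shift K (N + k) _ _ (by push_cast; ring)
    refine ⟨_, e', _, hX', he', ?_, hs⟩
    refine (isStrictlyGE_iff _ _).2 fun i hi ↦ (mappingCone.isZero_X_iff _ _).2 ⟨?_, ?_⟩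
    · exact isZero_of_isStrictlyGE (K⟦(-1 : ℤ)⟧) (N + (k + 1 : ℕ)) _
    · exact isZero_of_isStrictlyGE (K⟦(-1 : ℤ)⟧) (N + (k + 1 : ℕ)) _
  · intro D hD
    refine hasCoproduct_of_locallyFinite D fun n ↦ ⟨(n - N + 1).toNat, fun k hk ↦ ?_⟩
    obtain ⟨j, hkj, hj⟩ := hD k
    exact isZero_of_isStrictlyGE (D k).as (N + j) _

lemma isIdempotentComplete_hotCat_of_hasCountableCoproducts [HasCountableCoproducts A] :
    IsIdempotentComplete (HotCat A) where
  idempotents_split X e he := by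
    refine endoSplits_of_imageSum_step (fun _ _ ↦ True) ?_ ?_ trivial he
    · intro _ X e _ he
      obtain ⟨K, rfl⟩ := quotient_obj_surjective X
      obtain ⟨e', φ, he', hs⟩ := exists_imageSum_shift_one K he
      exact ⟨_, e', _, trivial, he', trivial, hs⟩
    · intro D _
      have : HasCoproductsOfShape ℕ A := HasCountableCoproducts.out ℕ
      exact hasCoproduct_quotient_obj fun k ↦ (D k).as

end HomotopyCategory

/-! ### Retracts of bounded complexes -/

section HomotopyCategory

variable {A : Type u} [Category.{v} A] [Preadditive A]

open HomotopyCategory CochainComplex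

/-- An idempotent endomorphism of complexes which is homotopic to the identity splits through a
homotopy equivalent complex, which vanishes where the idempotent does. -/
lemma exists_iso_of_idempotent_homotopic_id [IsIdempotentComplete A] {ι : Type} {c : ComplexShape ι}
    (K : HomologicalComplex A c) (ε : K ⟶ K) (hε : ε ≫ ε = ε)
    (h : (quotient A c).map ε = 𝟙 _) :
    ∃ L : HomologicalComplex A c, (∀ n, ε.f n = 0 → IsZero (L.X n)) ∧
      Nonempty ((quotient A c).obj L ≅ (quotient A c).obj K) := by
  obtain ⟨L, i, p, hip, hpi⟩ := IsIdempotentComplete.idempotents_split K ε hε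
  refine ⟨L, fun n hn ↦ ?_, ⟨⟨(quotient A c).map i, (quotient A c).map p, ?_, ?_⟩⟩⟩
  · have h1 : i.f n ≫ p.f n = 𝟙 _ := by rw [← HomologicalComplex.comp_f, hip]; rfl
    have h2 : p.f n ≫ i.f n = 0 := by rw [← HomologicalComplex.comp_f, hpi, hn]
    rw [IsZero.iff_id_eq_zero]
    calc 𝟙 (L.X n) = i.f n ≫ (p.f n ≫ i.f n) ≫ p.f n := by rw [assoc, h1, comp_id, h1]
      _ = 0 := by rw [h2, zero_comp, comp_zero]
  · rw [← CategoryTheory.Functor.map_comp, hip, CategoryTheory.Functor.map_id]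
  · rw [← CategoryTheory.Functor.map_comp, hpi, h]

/-- A retract, up to homotopy, of a complex `X` is contractible where `X` vanishes. -/
lemma exists_nullHomotopicMap_f_eq_id {X Y : CochainComplex A ℤ}
    (i : (quotient A (.up ℤ)).obj Y ⟶ (quotient A (.up ℤ)).obj X)
    (p : (quotient A (.up ℤ)).obj X ⟶ (quotient A (.up ℤ)).obj Y) (hip : i ≫ p = 𝟙 _) :
    ∃ h : ∀ n m, Y.X n ⟶ Y.X m, ∀ n, IsZero (X.X n) →
      (Homotopy.nullHomotopicMap h).f n = 𝟙 _ := by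
  obtain ⟨i, rfl⟩ := (quotient A (.up ℤ)).map_surjective i
  obtain ⟨p, rfl⟩ := (quotient A (.up ℤ)).map_surjective p
  rw [← CategoryTheory.Functor.map_comp, ← CategoryTheory.Functor.map_id] at hip
  let H := homotopyOfEq _ _ hip.symm
  refine ⟨H.hom, fun n hn ↦ ?_⟩
  have := H.comm n
  rw [HomologicalComplex.comp_f, hn.eq_of_tgt (i.f n) 0, zero_comp, add_zero] at this
  exact this.symm

/-- A complex which is contractible in degrees `< a` is homotopy equivalent to a complex which
vanishes there. In degree `a` one splits off the image of the differential, which is a direct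
summand because of the contraction. -/
lemma exists_isStrictlyGE_iso [IsIdempotentComplete A] (K : CochainComplex A ℤ) (a : ℤ)
    (h : ∀ n m, K.X n ⟶ K.X m) (hh : ∀ n < a, (Homotopy.nullHomotopicMap h).f n = 𝟙 _) :
    ∃ L : CochainComplex A ℤ, L.IsStrictlyGE a ∧ (∀ n, IsZero (K.X n) → IsZero (L.X n)) ∧
      Nonempty ((quotient A (.up ℤ)).obj L ≅ (quotient A (.up ℤ)).obj K) := by
  let h' (n m : ℤ) : K.X n ⟶ K.X m := if m + 1 = n ∧ n ≤ a then h n m else 0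
  have h'_pos (n m : ℤ) (h1 : m + 1 = n) (h2 : n ≤ a) : h' n m = h n m := if_pos ⟨h1, h2⟩
  have h'_neg (n m : ℤ) (h2 : a < n) : h' n m = 0 := if_neg (by lia)
  let ν := Homotopy.nullHomotopicMap h'
  have hf (k : ∀ n m, K.X n ⟶ K.X m) (n : ℤ) : (Homotopy.nullHomotopicMap k).f n =
      K.d n (n + 1) ≫ k (n + 1) n + k n (n - 1) ≫ K.d (n - 1) n :=
    Homotopy.nullHomotopicMap_f (c := .up ℤ) (by simp) (by simp) k
  have hν_lt (n : ℤ) (hn : n < a) : ν.f n = 𝟙 _ := by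
    rw [← hh n hn, hf, hf, h'_pos _ _ (by lia) (by lia), h'_pos _ _ (by lia) (by lia)]
  have hν_gt (n : ℤ) (hn : a < n) : ν.f n = 0 := by
    rw [hf, h'_neg _ _ (by lia), h'_neg _ _ (by lia), comp_zero, zero_comp, add_zero]
  have hν_eq : ν.f a = h a (a - 1) ≫ K.d (a - 1) a := by
    rw [hf, h'_neg _ _ (by lia), h'_pos _ _ (by lia) (by lia), comp_zero, zero_add]
  have hν : ν ≫ ν = ν := by
    ext n
    rw [HomologicalComplex.comp_f]
    rcases lt_trichotomy n a with hn | rfl | hn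
    · rw [hν_lt n hn, comp_id]
    · have h1 := hh (n - 1) (by lia)
      rw [hf, sub_add_cancel] at h1
      have h2 : K.d (n - 1) n ≫ h n (n - 1) =
        𝟙 _ - h (n - 1) (n - 1 - 1) ≫ K.d (n - 1 - 1) (n - 1) := by rw [← h1]; abel
      rw [hν_eq, assoc, ← assoc (K.d _ _), h2, Preadditive.sub_comp, assoc, K.d_comp_d,
        comp_zero, sub_zero, id_comp]
    · rw [hν_gt n hn, comp_zero]
  have hQ : (quotient A (.up ℤ)).map ν = 0 :=
    (quotient_map_eq_zero_iff _).2
      ⟨Homotopy.nullHomotopy h' fun n m hnm ↦ if_neg fun h ↦ hnm h.1⟩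
  obtain ⟨L, hL, e⟩ := exists_iso_of_idempotent_homotopic_id K (𝟙 K - ν)
    (Idempotents.idem_of_id_sub_idem _ hν)
    (by rw [Functor.map_sub, hQ, CategoryTheory.Functor.map_id, sub_zero])
  refine ⟨L, (isStrictlyGE_iff _ _).2 fun n hn ↦ hL n ?_, fun n hn ↦ hL n (hn.eq_of_src _ _), e⟩
  rw [HomologicalComplex.sub_f_apply, hν_lt n hn, HomologicalComplex.id_f, sub_self]

/-- A complex which is contractible in degrees `> b` is homotopy equivalent to a complex which
vanishes there. -/
lemma exists_isStrictlyLE_iso [IsIdempotentComplete A] (K : CochainComplex A ℤ) (b : ℤ)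
    (h : ∀ n m, K.X n ⟶ K.X m) (hh : ∀ n, b < n → (Homotopy.nullHomotopicMap h).f n = 𝟙 _) :
    ∃ L : CochainComplex A ℤ, L.IsStrictlyLE b ∧ (∀ n, IsZero (K.X n) → IsZero (L.X n)) ∧
      Nonempty ((quotient A (.up ℤ)).obj L ≅ (quotient A (.up ℤ)).obj K) := by
  let h' (n m : ℤ) : K.X n ⟶ K.X m := if m + 1 = n ∧ b < n then h n m else 0
  have h'_pos (n m : ℤ) (h1 : m + 1 = n) (h2 : b < n) : h' n m = h n m := if_pos ⟨h1, h2⟩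
  have h'_neg (n m : ℤ) (h2 : n ≤ b) : h' n m = 0 := if_neg (by lia)
  let ν := Homotopy.nullHomotopicMap h'
  have hf (k : ∀ n m, K.X n ⟶ K.X m) (n : ℤ) : (Homotopy.nullHomotopicMap k).f n =
      K.d n (n + 1) ≫ k (n + 1) n + k n (n - 1) ≫ K.d (n - 1) n :=
    Homotopy.nullHomotopicMap_f (c := .up ℤ) (by simp) (by simp) k
  have hν_gt (n : ℤ) (hn : b < n) : ν.f n = 𝟙 _ := by
    rw [← hh n hn, hf, hf, h'_pos _ _ (by lia) (by lia), h'_pos _ _ (by lia) (by lia)]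
  have hν_lt (n : ℤ) (hn : n < b) : ν.f n = 0 := by
    rw [hf, h'_neg _ _ (by lia), h'_neg _ _ (by lia), comp_zero, zero_comp, add_zero]
  have hν_eq : ν.f b = K.d b (b + 1) ≫ h (b + 1) b := by
    rw [hf, h'_pos _ _ (by lia) (by lia), h'_neg _ _ (by lia), zero_comp, add_zero]
  have hν : ν ≫ ν = ν := by
    ext n
    rw [HomologicalComplex.comp_f]
    rcases lt_trichotomy n b with hn | rfl | hn
    · rw [hν_lt n hn, comp_zero]
    · have h1 := hh (n + 1) (by lia)
      rw [hf, add_sub_cancel_right] at h1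
      have h2 : h (n + 1) n ≫ K.d n (n + 1) =
        𝟙 _ - K.d (n + 1) (n + 1 + 1) ≫ h (n + 1 + 1) (n + 1) := by rw [← h1]; abel
      rw [hν_eq, assoc, ← assoc (h _ _), h2, Preadditive.sub_comp, id_comp, assoc,
        Preadditive.comp_sub, K.d_comp_d_assoc, zero_comp, sub_zero]
    · rw [hν_gt n hn, comp_id]
  have hQ : (quotient A (.up ℤ)).map ν = 0 :=
    (quotient_map_eq_zero_iff _).2
      ⟨Homotopy.nullHomotopy h' fun n m hnm ↦ if_neg fun h ↦ hnm h.1⟩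
  obtain ⟨L, hL, e⟩ := exists_iso_of_idempotent_homotopic_id K (𝟙 K - ν)
    (Idempotents.idem_of_id_sub_idem _ hν)
    (by rw [Functor.map_sub, hQ, CategoryTheory.Functor.map_id, sub_zero])
  refine ⟨L, (isStrictlyLE_iff _ _).2 fun n hn ↦ hL n ?_, fun n hn ↦ hL n (hn.eq_of_src _ _), e⟩
  rw [HomologicalComplex.sub_f_apply, hν_gt n hn, HomologicalComplex.id_f, sub_self]

/-- A retract in the homotopy category of a bounded complex is homotopy equivalent to a bounded
complex. -/
lemma isoClosure_boundedObjects_of_retract [IsIdempotentComplete A] {X Y : HotCat A}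
    (hX : boundedObjects A X) (i : Y ⟶ X) (p : X ⟶ Y) (hip : i ≫ p = 𝟙 Y) :
    (boundedObjects A).isoClosure Y := by
  obtain ⟨K, rfl⟩ := quotient_obj_surjective X
  obtain ⟨K', rfl⟩ := quotient_obj_surjective Y
  obtain ⟨a, b, ha, hb⟩ := hX
  have ha : IsStrictlyGE K a := ha
  have hb : IsStrictlyLE K b := hb
  obtain ⟨h, hh⟩ := exists_nullHomotopicMap_f_eq_id i p hip
  obtain ⟨L, hL, -, ⟨φ⟩⟩ := exists_isStrictlyGE_iso K' a h fun n hn ↦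
    hh n (isZero_of_isStrictlyGE K a n hn)
  obtain ⟨h', hh'⟩ := exists_nullHomotopicMap_f_eq_id (φ.hom ≫ i)
    (p ≫ φ.inv) (by simp [reassoc_of% hip])
  obtain ⟨M, hM, hM', ⟨ψ⟩⟩ := exists_isStrictlyLE_iso L b h' fun n hn ↦
    hh' n (isZero_of_isStrictlyLE K b n hn)
  exact ⟨(quotient A (.up ℤ)).obj M, ⟨a, b, (isStrictlyGE_iff _ _).2 fun n hn ↦
    hM' n (isZero_of_isStrictlyGE L a n hn), hM⟩, ⟨(ψ ≪≫ φ).symm⟩⟩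

lemma isIdempotentComplete_fullSubcategory {C : Type*} [Category* C] (P : ObjectProperty C)
    (h : ∀ (X : C) (e : X ⟶ X), P X → e ≫ e = e →
      ∃ (Y : C) (i : Y ⟶ X) (p : X ⟶ Y), P Y ∧ i ≫ p = 𝟙 Y ∧ p ≫ i = e) :
    IsIdempotentComplete P.FullSubcategory where
  idempotents_split X e he := by
    obtain ⟨Y, i, p, hY, hip, hpi⟩ := h X.obj e.hom X.property
      (by rw [← ObjectProperty.FullSubcategory.comp_hom, he])
    exact ⟨⟨Y, hY⟩, ObjectProperty.homMk i, ObjectProperty.homMk p,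
      ObjectProperty.hom_ext _ hip, ObjectProperty.hom_ext _ hpi⟩

section

variable [HasZeroObject A] [HasBinaryBiproducts A] [HasFiniteBiproducts A]

lemma exists_splitting_of_isoClosure_boundedObjects [IsIdempotentComplete A] (X : HotCat A)
    (hX : (boundedObjects A).isoClosure X) (e : X ⟶ X) (he : e ≫ e = e) :
    ∃ (Y : HotCat A) (i : Y ⟶ X) (p : X ⟶ Y), boundedObjects A Y ∧ i ≫ p = 𝟙 Y ∧ p ≫ i = e := by
  obtain ⟨X₀, hX₀, ⟨φ⟩⟩ := hX
  obtain ⟨Y, i, p, hip, hpi⟩ := endoSplits_of_isStrictlyLE X₀ _ hX₀.choose_spec.choose_spec.2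
    (e := φ.inv ≫ e ≫ φ.hom) (by simp [reassoc_of% he])
  obtain ⟨Z, hZ, ⟨ψ⟩⟩ := isoClosure_boundedObjects_of_retract hX₀ i p hip
  refine ⟨Z, ψ.inv ≫ i ≫ φ.inv, φ.hom ≫ p ≫ ψ.hom, hZ, by simp [reassoc_of% hip], ?_⟩
  simp [reassoc_of% hpi]

lemma isIdempotentComplete_hotCatBounded [IsIdempotentComplete A] :
    IsIdempotentComplete (HotCatBounded A) :=
  isIdempotentComplete_fullSubcategory _ fun X e hX he ↦
    exists_splitting_of_isoClosure_boundedObjects X ((boundedObjects A).le_isoClosure _ hX) e he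

lemma isIdempotentComplete_hotCatBoundedClosure [IsIdempotentComplete A] :
    IsIdempotentComplete (HotCatBoundedClosure A) :=
  isIdempotentComplete_fullSubcategory _ fun X e hX he ↦ by
    obtain ⟨Y, i, p, hY, h⟩ := exists_splitting_of_isoClosure_boundedObjects X hX e he
    exact ⟨Y, i, p, (boundedObjects A).le_isoClosure _ hY, h⟩

end

end HomotopyCategory

/-! ### Canonical truncations of complexes in abelian categories -/

section Truncation

open HomotopyCategory CochainComplex

/-- If `φ` is an isomorphism in degrees `< a + 1`, its mapping cone is contractible in
degrees `< a`. -/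
lemma mappingCone_exists_nullHomotopicMap_f_eq_id {A : Type u} [Category.{v} A] [Preadditive A]
    [HasBinaryBiproducts A] {U X : CochainComplex A ℤ} (φ : U ⟶ X) (a : ℤ)
    (hφ : ∀ n ≤ a, IsIso (φ.f n)) :
    ∃ h : ∀ n m, (mappingCone φ).X n ⟶ (mappingCone φ).X m,
      ∀ n < a, (Homotopy.nullHomotopicMap h).f n = 𝟙 _ := by
  let h (n m : ℤ) : (mappingCone φ).X n ⟶ (mappingCone φ).X m :=
    if hn : n ≤ a ∧ m + 1 = n then
      (mappingCone.snd φ).v n n (by lia) ≫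
        (have := hφ n hn.1; inv (φ.f n)) ≫ (mappingCone.inl φ).v n m (by lia)
    else 0
  refine ⟨h, fun n hn ↦ ?_⟩
  have := hφ n (by lia)
  have := hφ (n + 1) (by lia)
  have h1 : h (n + 1) n = (mappingCone.snd φ).v (n + 1) (n + 1) (by lia) ≫ inv (φ.f (n + 1)) ≫
      (mappingCone.inl φ).v (n + 1) n (by lia) := dif_pos ⟨by lia, rfl⟩
  have h2 : h n (n - 1) = (mappingCone.snd φ).v n n (by lia) ≫ inv (φ.f n) ≫
      (mappingCone.inl φ).v n (n - 1) (by lia) := dif_pos ⟨by lia, by lia⟩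
  have h3 : inv (φ.f n) ≫ U.d n (n + 1) = X.d n (n + 1) ≫ inv (φ.f (n + 1)) := by
    rw [IsIso.inv_comp_eq, ← assoc, IsIso.eq_comp_inv, φ.comm]
  rw [Homotopy.nullHomotopicMap_f (c := .up ℤ) (k₂ := n - 1) (k₀ := n + 1) (by simp) (by simp) h,
    h1, h2, mappingCone.d_snd_v_assoc φ n (n + 1) rfl, assoc, assoc,
    mappingCone.inl_v_d φ n (n - 1) (n + 1) (by lia) (by lia), Preadditive.comp_sub,
    IsIso.inv_hom_id_assoc, reassoc_of% h3, Preadditive.comp_sub, Preadditive.add_comp, assoc,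
    IsIso.hom_inv_id_assoc, assoc, ← mappingCone.id_X φ n (n + 1) rfl]
  abel

/-- If `i` is a degreewise monomorphism which is invertible in degrees `< a`, it detects
null-homotopic maps out of complexes which vanish in degrees `> a`. -/
lemma quotient_map_eq_zero_of_comp_eq_zero {A : Type u} [Category.{v} A] [Preadditive A]
    {U W X : CochainComplex A ℤ} (a : ℤ) [U.IsStrictlyLE a] (f : U ⟶ W) (i : W ⟶ X)
    [∀ n, Mono (i.f n)] (hi : ∀ n < a, IsIso (i.f n))
    (h : (quotient A (.up ℤ)).map (f ≫ i) = 0) : (quotient A (.up ℤ)).map f = 0 := by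
  obtain ⟨H⟩ := (quotient_map_eq_zero_iff _).1 h
  let h' (n m : ℤ) : U.X n ⟶ W.X m :=
    if hm : m < a then H.hom n m ≫ (have := hi m hm; inv (i.f m)) else 0
  have hh' (n m : ℤ) : h' n m ≫ i.f m = H.hom n m := by
    by_cases hm : m < a
    · have := hi m hm
      have : h' n m = H.hom n m ≫ inv (i.f m) := dif_pos hm
      rw [this, assoc, IsIso.inv_hom_id, comp_id]
    · have : h' n m = 0 := dif_neg hm
      rw [this, zero_comp]
      by_cases hnm : m + 1 = n
      · exact (U.isZero_of_isStrictlyLE a n).eq_of_src _ _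
      · exact (H.zero n m hnm).symm
  refine (quotient_map_eq_zero_iff _).2 ⟨⟨h', fun n m hnm ↦ ?_, fun n ↦ ?_⟩⟩
  · rw [← cancel_mono (i.f m), hh', H.zero n m hnm, zero_comp]
  · rw [← cancel_mono (i.f n), ← HomologicalComplex.comp_f, H.comm n, HomologicalComplex.zero_f,
      HomologicalComplex.zero_f, add_zero, add_zero, Preadditive.add_comp, ← dNext_comp_right,
      ← prevD_comp_right]
    simp only [hh']

lemma isIso_ιTruncLE_f {A : Type u} [Category.{v} A] [Abelian A]
    (K : CochainComplex A ℤ) (a n : ℤ) (hn : n < a) : IsIso ((K.ιTruncLE a).f n) := by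
  let e := ComplexShape.embeddingUpIntLE a
  obtain ⟨i, hi⟩ : ∃ i : ℕ, e.f i = n := ⟨(a - n).natAbs, by
    change a - ((a - n).natAbs : ℤ) = n
    lia⟩
  have hi' : ¬ e.BoundaryLE i := fun h ↦ by
    rw [ComplexShape.boundaryLE_embeddingUpIntLE_iff] at h
    subst h
    change a - ((0 : ℕ) : ℤ) = n at hi
    lia
  have : IsIso ((HomologicalComplex.πTruncGE (HomologicalComplex.op K) e.op).f n) := by
    exact (e.op.isIso_liftExtend_f_iff _ _ hi).2
      (HomologicalComplex.isIso_restrictionToTruncGE' _ e.op i (by simpa))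
  change IsIso ((HomologicalComplex.πTruncGE (HomologicalComplex.op K) e.op).f n).unop
  infer_instance

lemma isIdempotentComplete_hotCat_of_abelian {A : Type u} [Category.{v} A] [Abelian A] :
    IsIdempotentComplete (HotCat A) where
  idempotents_split X e he := by
    obtain ⟨(K : CochainComplex A ℤ), rfl⟩ := quotient_obj_surjective X
    obtain ⟨(ε : K ⟶ K), rfl⟩ := (quotient A (.up ℤ)).map_surjective e
    have := Abelian.hasFiniteBiproducts (C := A)
    let Q := quotient A (.up ℤ)
    let ι : K.truncLE 0 ⟶ K := K.ιTruncLE 0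
    let α : K.truncLE 0 ⟶ K.truncLE 0 := truncLEMap ε 0
    have hα : α ≫ ι = ι ≫ ε := ιTruncLE_naturality ε 0
    have hι (n : ℤ) (hn : n < 0) : IsIso (ι.f n) := isIso_ιTruncLE_f K 0 n hn
    have hU : (K.truncLE 0).IsStrictlyLE 0 := inferInstance
    have : ∀ n, Mono (ι.f n) := fun n ↦
      inferInstanceAs (Mono ((HomologicalComplex.ιTruncLE K _).f n))
    -- Morphisms to `K` from a complex vanishing in positive degrees lift uniquely to the
    -- truncation, also up to homotopy; hence `α` inherits idempotency from `ε`.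
    have hαα : Q.map α ≫ Q.map α = Q.map α := by
      rw [← sub_eq_zero, ← Q.map_comp, ← Q.map_sub]
      refine quotient_map_eq_zero_of_comp_eq_zero 0 _ ι hι ?_
      have : (α ≫ α - α) ≫ ι = ι ≫ (ε ≫ ε - ε) := by
        rw [Preadditive.sub_comp, assoc, hα, reassoc_of% hα, Preadditive.comp_sub]
      rw [this, Functor.map_comp, Functor.map_sub, Functor.map_comp, he, sub_self, comp_zero]
    have hT := mappingCone_triangleh_distinguished ι
    obtain ⟨h, hh⟩ := mappingCone_exists_nullHomotopicMap_f_eq_id ι (-1)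
      fun n hn ↦ hι n (by lia)
    obtain ⟨V, hV, -, ⟨φ⟩⟩ := exists_isStrictlyGE_iso (mappingCone ι) (-1) h hh
    have hcone (b : Q.obj (mappingCone ι) ⟶ Q.obj (mappingCone ι)) (hb : b ≫ b = b) :
        EndoSplits b :=
      Idempotents.split_imp_of_iso φ (φ.hom ≫ b ≫ φ.inv) b (by simp)
        (endoSplits_of_isStrictlyGE (Q.obj V) (-1) hV (by simp [reassoc_of% hb]))
    refine endoSplits_of_distinguished (Q.map ι) (mappingCone.triangleh ι).mor₂
      (mappingCone.triangleh ι).mor₃ hT (a := Q.map α) (fun a ha ↦ ?_) hcone hαα he ?_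
    · exact endoSplits_of_isStrictlyLE _ 0 hU ha
    · rw [← Q.map_comp, ← hα, Q.map_comp]

end Truncation

end

theorem theorem3p4 (A : Type u) [Category.{v} A] [Preadditive A] [HasZeroObject A]
    [HasFiniteBiproducts A] :
    (Nonempty (Abelian A) → IsIdempotentComplete (HotCat A)) ∧
    (HasCountableCoproducts A → IsIdempotentComplete (HotCat A)) ∧
    (IsIdempotentComplete A →
      IsIdempotentComplete (HotCatBounded A) ∧
      IsIdempotentComplete (HotCatBoundedClosure A)) := by
  have := hasBinaryBiproducts_of_finite_biproducts A
  refine ⟨fun ⟨hA⟩ ↦ ?_, fun _ ↦ isIdempotentComplete_hotCat_of_hasCountableCoproducts,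
    fun _ ↦ ⟨isIdempotentComplete_hotCatBounded, isIdempotentComplete_hotCatBoundedClosure⟩⟩
  -- The preadditive structure underlying `hA` agrees with the given one.
  rename_i inst _ _ _
  obtain rfl : inst = hA.toPreadditive := Subsingleton.elim _ _
  exact isIdempotentComplete_hotCat_of_abelian
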